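/- For a number field $K$ with ring of integers $\mathcal O_K$, let $D_K$ be the absolute value of its discriminant, and for a positive integer $\ell$ let $\mathrm{Cl}_K[\ell]=\{c\in \mathrm{Cl}_K : c^\ell=1\}$ be the $\ell$-torsion of its ideal class group. For a nonzero prime ideal $\mathfrak p$ of $\mathcal O_K$ let $N(\mathfrak p)$ be its norm, and let $e(\mathfrak p)$ and $f(\mathfrak p)$ be its ramification index and inertia degree over the rational prime below it. Let $H_K(\alpha)=\prod_{v}\max\{1,|\alpha|_v\}^{[K_v:\mathbb Q_v]}$ be the multiplicative Weil height relative to $K$; here $v$ runs over all places of $K$, and $|\cdot|_v$ extends the usual archimedean or $p$-adic absolute value on $\mathbb Q$. Put $$\eta_\ell(K)=\inf\left\{H_K(\alpha) : \alpha\in K,\ \alpha\mathcal O_K=(\mathfrak p_1\mathfrak p_2^{-1})^\ell,\ \mathfrak p_1\ne\mathfrak p_2 \text{ prime ideals of } \mathcal O_K \text{ with } e(\mathfrak p_i)=f(\mathfrak p_i)=1 \text{ for } i=1,2\right\}.$$ **Proposition 2.1.** For every positive integer $d$, every real $\delta$ and every real $\varepsilon>0$ there is a constant $C>0$, depending only on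 $d,\delta,\varepsilon$, with the following property. Let $\ell$ be a positive integer with $\delta<1/\ell$, and let $K$ be a number field of degree $d$. Suppose that there are $M>0$ (distinct) prime ideals $\mathfrak p$ of $\mathcal O_K$ with $e(\mathfrak p)=f(\mathfrak p)=1$ and $N(\mathfrak p)\le \eta_\ell(K)^{\delta}$. Then $$\#\mathrm{Cl}_K[\ell]\le C\,D_K^{1/2+\varepsilon}\,M^{-1}.$$ -/

import Mathlib

open NumberField
open scoped nonZeroDivisors

section

variable (K : Type*) [Field K] [NumberField K]

/-- The absolute value `D_K` of the discriminant of `K`, as a real number. -/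
noncomputable def absDiscr : ℝ := |(NumberField.discr K : ℝ)|

/-- The `ℓ`-torsion subgroup `Cl_K[ℓ]` of the ideal class group of `K`:
the classes `c` with `c ^ ℓ = 1`. -/
noncomputable def classGroupTorsion (ℓ : ℕ) : Subgroup (ClassGroup (𝓞 K)) :=
  (powMonoidHom ℓ : ClassGroup (𝓞 K) →* ClassGroup (𝓞 K)).ker

variable {K}

/-- `𝔭` is a nonzero prime ideal of `𝓞 K` with ramification index and inertia degree `1` over the
rational prime below it. -/
def IsDegreeOneUnramified (𝔭 : Ideal (𝓞 K)) : Prop :=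
  𝔭.IsPrime ∧ 𝔭 ≠ ⊥ ∧ 𝔭.ramificationIdx ℤ = 1 ∧ 𝔭.inertiaDeg ℤ = 1

variable (K)

/-- The invariant `η_ℓ(K)`: the infimum of the multiplicative Weil heights (relative to `K`) of the
`α ∈ K` with `α 𝓞_K = (𝔭₁ 𝔭₂⁻¹) ^ ℓ`, an equality of fractional ideals, where `𝔭₁ ≠ 𝔭₂` are prime
ideals with ramification index and inertia degree `1`. -/
noncomputable def eta (ℓ : ℕ) : ℝ :=
  sInf {h : ℝ | ∃ α : K, h = Height.mulHeight₁ α ∧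
    ∃ 𝔭₁ 𝔭₂ : Ideal (𝓞 K), 𝔭₁ ≠ 𝔭₂ ∧ IsDegreeOneUnramified 𝔭₁ ∧ IsDegreeOneUnramified 𝔭₂ ∧
      FractionalIdeal.spanSingleton (𝓞 K)⁰ α =
        ((𝔭₁ : FractionalIdeal (𝓞 K)⁰ K) * (𝔭₂ : FractionalIdeal (𝓞 K)⁰ K)⁻¹) ^ ℓ}

end

/-!
The proof attaches to each pair `(c, 𝔭)`, with `c` an `ℓ`-torsion class and `𝔭` one of the `M` given
primes, a bounded amount of data that determines the pair, and counts the possible data.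

Represent `c` by an ideal `I` with `I ^ ℓ = (γ)`, and weight the archimedean place `w` by
`|γ|_w ^ (1 / ℓ) * N(𝔭) ^ (1 / d)`. The product of the weights is `N(I * 𝔭)`, so Minkowski's theorem
gives a nonzero `x ∈ I * 𝔭` whose size relative to the weights is less than `T` at every place, where
`T ^ d = 2 √D_K` (`exists_reduced`). The data are the integral ideal `A = (x) * (I * 𝔭)⁻¹`, of norm at
most `2 √D_K`, and the relative sizes of `x` rounded to a logarithmic scale of mesh `κ`.

If `(c, 𝔭)` and `(c', 𝔭')` have the same data, then `α = (x / x') ^ ℓ * γ' / γ` generates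
`(𝔭 * 𝔭'⁻¹) ^ ℓ`, and its height is at most `exp (d ℓ κ) * max (N 𝔭) (N 𝔭') ^ ℓ`
(`mulHeight₁_quotient_le`). Both norms are at most `η ^ δ`, so this is less than `η` once `κ` is small
in terms of `d`, `δ` and `ℓ`: the existence of `𝔭` forces `η ^ δ ≥ 2`, and `δ * ℓ < 1`
(`exp_mul_rpow_pow_lt`). By the definition of `η` this gives `𝔭 = 𝔭'`, and then the equality of the
ideals `A` gives `c = c'`.

Hence `#Cl_K[ℓ] * M` is at most the number of ideals of norm at most `2 √D_K` times a power of
`log D_K` (`card_torsion_mul_card_le`). The number of ideals is bounded by Rankin's method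
(`card_ideals_le`): an ideal is determined by a `d`-tuple of positive integers whose product is its
norm, because there are at most `d` primes above each rational prime. Neither regulators nor values
of the Dedekind zeta function enter.
-/

/-! ### Counting ideals of bounded norm -/

section IdealCount

variable {K : Type*} [Field K] [NumberField K]

theorem card_primesOver_le_finrank (p : Ideal ℤ) [p.IsMaximal] :
    Fintype.card (p.primesOver (𝓞 K)) ≤ Module.finrank ℚ K := by
  rw [← RingOfIntegers.rank K, ← Ideal.sum_ramification_inertia_eq_finrank p (𝓞 K),
    ← Finset.card_univ, Finset.card_eq_sum_ones]
  refine Finset.sum_le_sum fun q _ ↦ ?_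
  have : q.1.IsPrime := q.2.1
  exact Nat.mul_pos (q.1.ramificationIdx_pos ℤ) (q.1.inertiaDeg_pos ℤ)

variable (K) in
/-- The primes of `𝓞 K` can be coloured with `[K : ℚ]` colours so that distinct primes above the
same rational prime have distinct colours. -/
theorem exists_prime_coloring :
    ∃ c : Ideal (𝓞 K) → Fin (Module.finrank ℚ K), ∀ (p : ℕ), p.Prime →
      ∀ P Q : Ideal (𝓞 K), P.IsPrime → Q.IsPrime → (p : 𝓞 K) ∈ P → (p : 𝓞 K) ∈ Q →
        c P = c Q → P = Q := by
  classical
  have hpos : 0 < Module.finrank ℚ K := Module.finrank_pos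
  have key : ∀ p : Ideal ℤ, ∃ c : p.primesOver (𝓞 K) → Fin (Module.finrank ℚ K),
      p.IsMaximal → Function.Injective c := by
    intro p
    by_cases hp : p.IsMaximal
    · have h := card_primesOver_le_finrank (K := K) p
      rw [← Fintype.card_fin (Module.finrank ℚ K)] at h
      obtain ⟨e⟩ := Function.Embedding.nonempty_of_card_le h
      exact ⟨e, fun _ ↦ e.injective⟩
    · exact ⟨fun _ ↦ ⟨0, hpos⟩, fun h ↦ absurd h hp⟩
  choose c hc using key
  let c' (P : Ideal (𝓞 K)) : Fin (Module.finrank ℚ K) :=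
    if h : P ∈ (P.under ℤ).primesOver (𝓞 K) then c _ ⟨P, h⟩ else ⟨0, hpos⟩
  have hc' (p : Ideal ℤ) (P : Ideal (𝓞 K)) (h : P ∈ p.primesOver (𝓞 K)) : c' P = c p ⟨P, h⟩ := by
    obtain rfl : p = P.under ℤ := h.2.over
    simp only [c', dif_pos h]
  refine ⟨c', fun p hp P Q hP hQ hpP hpQ hPQ ↦ ?_⟩
  have hpZ : Prime (p : ℤ) := Nat.prime_iff_prime_int.mp hp
  have hmax : (Ideal.span {(p : ℤ)}).IsMaximal :=
    ((Ideal.span_singleton_prime hpZ.ne_zero).2 hpZ).isMaximal (by simpa using hp.ne_zero)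
  have hover (P : Ideal (𝓞 K)) (hP : P.IsPrime) (h : (p : 𝓞 K) ∈ P) :
      P ∈ (Ideal.span {(p : ℤ)}).primesOver (𝓞 K) := by
    refine ⟨hP, ⟨hmax.eq_of_le (Ideal.IsPrime.under ℤ P).ne_top ?_⟩⟩
    rw [Ideal.span_singleton_le_iff_mem, Ideal.mem_comap]
    simpa using h
  rw [hc' _ P (hover P hP hpP), hc' _ Q (hover Q hQ hpQ)] at hPQ
  exact congrArg Subtype.val (hc _ hmax hPQ)

open UniqueFactorizationMonoid in
/-- The norm of the part of the ideal `I` supported on the primes of colour `i`. -/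
noncomputable def colorNorm {d : ℕ} (c : Ideal (𝓞 K) → Fin d) (I : Ideal (𝓞 K)) (i : Fin d) : ℕ :=
  (((normalizedFactors I).filter (c · = i)).map Ideal.absNorm).prod

theorem prod_colorNorm {d : ℕ} (c : Ideal (𝓞 K) → Fin d) {I : Ideal (𝓞 K)} (hI : I ≠ ⊥) :
    ∏ i, colorNorm c I i = Ideal.absNorm I := by
  have key (S : Multiset (Ideal (𝓞 K))) :
      ∏ i, ((S.filter (c · = i)).map Ideal.absNorm).prod = (S.map Ideal.absNorm).prod := by
    induction S using Multiset.induction with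
    | empty => simp
    | cons P S ih =>
      have (i : Fin d) : (((P ::ₘ S).filter (c · = i)).map Ideal.absNorm).prod =
          (if c P = i then Ideal.absNorm P else 1) *
            ((S.filter (c · = i)).map Ideal.absNorm).prod := by
        by_cases h : c P = i <;> simp [h]
      rw [Finset.prod_congr rfl fun i _ ↦ this i, Finset.prod_mul_distrib, ih]
      simp
  rw [← Ideal.prod_normalizedFactors_eq_self hI, map_multiset_prod, ← key]
  simp [colorNorm, Ideal.prod_normalizedFactors_eq_self hI]

/-- An ideal is determined by the norms of its monochromatic parts, because each of these norms
determines the multiplicities of all primes of the colour in question. -/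
theorem colorNorm_injOn {d : ℕ} {c : Ideal (𝓞 K) → Fin d}
    (hc : ∀ (p : ℕ), p.Prime → ∀ P Q : Ideal (𝓞 K), P.IsPrime → Q.IsPrime →
      (p : 𝓞 K) ∈ P → (p : 𝓞 K) ∈ Q → c P = c Q → P = Q) :
    Set.InjOn (colorNorm c) {I : Ideal (𝓞 K) | I ≠ ⊥} := by
  classical
  open UniqueFactorizationMonoid in
  have key (P : Ideal (𝓞 K)) (hP : P.IsPrime) (p n : ℕ) (hp : p.Prime) (hpP : (p : 𝓞 K) ∈ P)
      (hN : Ideal.absNorm P = p ^ n) (S : Multiset (Ideal (𝓞 K)))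
      (hS : ∀ Q ∈ S, Q.IsPrime ∧ Q ≠ ⊥) :
      ((S.filter (c · = c P)).map Ideal.absNorm).prod ≠ 0 ∧
      ((S.filter (c · = c P)).map Ideal.absNorm).prod.factorization p = S.count P * n := by
    induction S using Multiset.induction with
    | empty => simp
    | cons Q S ih =>
      obtain ⟨h0, ih⟩ := ih fun Q hQ ↦ hS Q (Multiset.mem_cons_of_mem hQ)
      obtain ⟨hQ, hQ0⟩ := hS Q (Multiset.mem_cons_self _ _)
      have hNQ : Ideal.absNorm Q ≠ 0 := by simpa [Ideal.absNorm_eq_zero_iff] using hQ0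
      by_cases h : c Q = c P
      · rw [Multiset.filter_cons_of_pos (p := (c · = c P)) _ h, Multiset.map_cons, Multiset.prod_cons]
        refine ⟨mul_ne_zero hNQ h0, ?_⟩
        rw [Nat.factorization_mul hNQ h0, Finsupp.add_apply, ih]
        by_cases hPQ : P = Q
        · subst hPQ
          rw [hN, Multiset.count_cons_self, hp.factorization_pow]
          simp; ring
        · rw [Multiset.count_cons_of_ne hPQ]
          have : (Ideal.absNorm Q).factorization p = 0 := by
            have := hQ.isMaximal hQ0
            obtain ⟨q, m, -, hqQ, hq, hNq⟩ := Ideal.exists_prime_and_absNorm_eq_pow Q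
            rw [hNq, hq.factorization_pow]
            refine Finsupp.single_eq_of_ne ?_
            rintro rfl
            exact hPQ (hc p hp P Q hP hQ hpP hqQ h.symm)
          omega
      · rw [Multiset.filter_cons_of_neg (p := (c · = c P)) _ h, Multiset.count_cons_of_ne]
        · exact ⟨h0, ih⟩
        · rintro rfl
          exact h rfl
  intro I hI J hJ hIJ
  have hfac (I : Ideal (𝓞 K)) (hI : I ≠ ⊥) :
      ∀ Q ∈ UniqueFactorizationMonoid.normalizedFactors I, Q.IsPrime ∧ Q ≠ ⊥ := fun Q hQ ↦
    have h := UniqueFactorizationMonoid.prime_of_normalized_factor Q hQ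
    ⟨Ideal.isPrime_of_prime h, h.ne_zero⟩
  rw [← Ideal.prod_normalizedFactors_eq_self hI, ← Ideal.prod_normalizedFactors_eq_self hJ]
  congr 1
  ext P
  by_cases hP : P.IsPrime ∧ P ≠ ⊥
  · have := hP.1.isMaximal hP.2
    obtain ⟨p, n, hn, hpP, hp, hN⟩ := Ideal.exists_prime_and_absNorm_eq_pow P
    refine Nat.eq_of_mul_eq_mul_right hn ?_
    rw [← (key P hP.1 p n hp hpP hN _ (hfac I hI)).2, ← (key P hP.1 p n hp hpP hN _ (hfac J hJ)).2]
    exact congrArg (fun m : ℕ ↦ m.factorization p) (congrFun hIJ (c P))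
  · rw [Multiset.count_eq_zero_of_notMem fun h ↦ hP (hfac I hI P h),
      Multiset.count_eq_zero_of_notMem fun h ↦ hP (hfac J hJ P h)]

/-- Rankin's bound for the number of ideals of norm at most `X`, with a constant depending on `K`
only through its degree. -/
theorem card_ideals_le {s : ℝ} (hs : 1 < s) {X : ℝ} (hX : 0 ≤ X) (A : Finset (Ideal (𝓞 K)))
    (hA : ∀ I ∈ A, I ≠ ⊥ ∧ (Ideal.absNorm I : ℝ) ≤ X) :
    (A.card : ℝ) ≤ X ^ s * (∑' n : ℕ, (n : ℝ) ^ (-s)) ^ Module.finrank ℚ K := by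
  classical
  obtain ⟨c, hc⟩ := exists_prime_coloring K
  have hsum : Summable fun n : ℕ ↦ (n : ℝ) ^ (-s) := Real.summable_nat_rpow.2 (by linarith)
  have hNpos (I) (hI : I ∈ A) : 0 < (Ideal.absNorm I : ℝ) := by
    have := (hA I hI).1
    rw [Nat.cast_pos, Nat.pos_iff_ne_zero]
    simpa [Ideal.absNorm_eq_zero_iff] using this
  let T : Finset (Fin (Module.finrank ℚ K) → ℕ) :=
    Fintype.piFinset fun _ ↦ Finset.range (⌊X⌋₊ + 1)
  have hmaps : ∀ I ∈ A, colorNorm c I ∈ T := by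
    intro I hI
    refine Fintype.mem_piFinset.2 fun i ↦ Finset.mem_range.2 (Nat.lt_succ_of_le ?_)
    have h1 : Ideal.absNorm I ≤ ⌊X⌋₊ := Nat.le_floor (hA I hI).2
    refine (Nat.le_of_dvd ?_ ?_).trans h1
    · exact_mod_cast hNpos I hI
    · rw [← prod_colorNorm c (hA I hI).1]
      exact Finset.dvd_prod_of_mem _ (Finset.mem_univ i)
  calc (A.card : ℝ) = ∑ I ∈ A, 1 := by simp
    -- Rankin's trick: every summand on the right is at least `1`.
    _ ≤ ∑ I ∈ A, X ^ s * (Ideal.absNorm I : ℝ) ^ (-s) := by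
        refine Finset.sum_le_sum fun I hI ↦ ?_
        rw [Real.rpow_neg (hNpos I hI).le, ← div_eq_mul_inv,
          one_le_div (Real.rpow_pos_of_pos (hNpos I hI) s)]
        exact Real.rpow_le_rpow (hNpos I hI).le (hA I hI).2 (by linarith)
    _ = X ^ s * ∑ I ∈ A, ∏ i, (colorNorm c I i : ℝ) ^ (-s) := by
        rw [Finset.mul_sum]
        refine Finset.sum_congr rfl fun I hI ↦ ?_
        rw [Real.finsetProd_rpow _ _ fun i _ ↦ Nat.cast_nonneg _, ← Nat.cast_prod,
          prod_colorNorm c (hA I hI).1]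
    _ = X ^ s * ∑ t ∈ A.image (colorNorm c), ∏ i, (t i : ℝ) ^ (-s) := by
        rw [Finset.sum_image fun I hI J hJ ↦ colorNorm_injOn hc (hA I hI).1 (hA J hJ).1]
    _ ≤ X ^ s * ∑ t ∈ T, ∏ i, (t i : ℝ) ^ (-s) := by
        gcongr
        exact Finset.image_subset_iff.2 hmaps
    _ = X ^ s * (∑ n ∈ Finset.range (⌊X⌋₊ + 1), (n : ℝ) ^ (-s)) ^ Module.finrank ℚ K := by
        rw [← Finset.prod_univ_sum (fun _ ↦ Finset.range (⌊X⌋₊ + 1)) fun _ n ↦ (n : ℝ) ^ (-s)]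
        simp
    _ ≤ _ := by
        gcongr
        exact hsum.sum_le_tsum _ fun n _ ↦ by positivity

end IdealCount

/-! ### Minkowski's theorem and the height of a quotient -/

section ArchimedeanSize

variable {K : Type*} [Field K] [NumberField K]

theorem one_le_absDiscr : 1 ≤ absDiscr K := by
  rw [absDiscr]
  exact_mod_cast Int.one_le_abs (NumberField.discr_ne_zero K)

open NumberField.mixedEmbedding NumberField.InfinitePlace in
/-- Minkowski's theorem for an integral ideal and a box with prescribed sides. -/
theorem exists_ne_zero_mem_ideal_forall_lt {I : Ideal (𝓞 K)} (hI : I ≠ ⊥) {f : InfinitePlace K → ℝ}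
    (hf : ∀ w, 0 < f w)
    (h : 2 * √(absDiscr K) * Ideal.absNorm I ≤ ∏ w, f w ^ w.mult) :
    ∃ x ∈ I, x ≠ 0 ∧ ∀ w : InfinitePlace K, w x < f w := by
  classical
  have hIu : (I : FractionalIdeal (𝓞 K)⁰ K) ≠ 0 := by simpa using hI
  let J : (FractionalIdeal (𝓞 K)⁰ K)ˣ := Units.mk0 _ hIu
  have hN : 0 < (Ideal.absNorm I : ℝ) := by
    rw [Nat.cast_pos, Nat.pos_iff_ne_zero]
    simpa [Ideal.absNorm_eq_zero_iff] using hI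
  have hD : 0 < √(absDiscr K) := Real.sqrt_pos.2 (one_le_absDiscr.trans_lt' one_pos)
  let g : InfinitePlace K → NNReal := fun w ↦ ⟨f w, (hf w).le⟩
  have hbound : minkowskiBound K J = (((Ideal.absNorm I : NNReal) *
      (2⁻¹ ^ nrComplexPlaces K * NNReal.sqrt ‖discr K‖₊) * 2 ^ Module.finrank ℚ K : NNReal) :
        ENNReal) := by
    rw [minkowskiBound, volume_fundamentalDomain_fractionalIdealLatticeBasis,
      volume_fundamentalDomain_latticeBasis, mixedEmbedding.finrank]
    have : (FractionalIdeal.absNorm (J : FractionalIdeal (𝓞 K)⁰ K)) = (Ideal.absNorm I : ℚ) :=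
      FractionalIdeal.coeIdeal_absNorm I
    rw [this]
    push_cast
    rw [ENNReal.ofReal_natCast]
  have hlt : minkowskiBound K J < MeasureTheory.volume (convexBodyLT K g) := by
    rw [hbound, convexBodyLT_volume, ← ENNReal.coe_mul, ENNReal.coe_lt_coe, ← NNReal.coe_lt_coe]
    have h1 : (Ideal.absNorm I : ℝ) * √(absDiscr K) < ∏ w, f w ^ w.mult := by
      refine lt_of_lt_of_le ?_ h
      nlinarith [mul_pos hN hD]
    have h2 : (2 : ℝ) ^ Module.finrank ℚ K * 2⁻¹ ^ nrComplexPlaces K ≤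
        2 ^ nrRealPlaces K * Real.pi ^ nrComplexPlaces K := by
      rw [← card_add_two_mul_card_eq_rank, pow_add, mul_assoc, pow_mul, ← mul_pow]
      gcongr
      norm_num
      exact Real.two_le_pi
    have h3 : ‖discr K‖ = absDiscr K := Int.norm_eq_abs _
    have h4 : (∏ w, (g w : ℝ) ^ w.mult) = ∏ w, f w ^ w.mult := rfl
    push_cast
    rw [h3, h4, NNReal.coe_real_pi]
    calc (Ideal.absNorm I : ℝ) * (2⁻¹ ^ nrComplexPlaces K * √(absDiscr K)) * 2 ^ Module.finrank ℚ K
        = ((2 : ℝ) ^ Module.finrank ℚ K * 2⁻¹ ^ nrComplexPlaces K) *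
          ((Ideal.absNorm I : ℝ) * √(absDiscr K)) := by ring
      _ < ((2 : ℝ) ^ Module.finrank ℚ K * 2⁻¹ ^ nrComplexPlaces K) * ∏ w, f w ^ w.mult := by
          gcongr
      _ ≤ _ := by
          gcongr
          exact Finset.prod_nonneg fun w _ ↦ pow_nonneg (hf w).le _
  obtain ⟨a, ha, ha0, hlt⟩ := exists_ne_zero_mem_ideal_lt K J hlt
  obtain ⟨x, hx, rfl⟩ := (FractionalIdeal.mem_coeIdeal (𝓞 K)⁰).1 ha
  refine ⟨x, hx, ?_, hlt⟩
  rintro rfl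
  simp at ha0

theorem prod_infinitePlace_eq_absNorm_span (x : 𝓞 K) :
    ∏ w : InfinitePlace K, w x ^ w.mult = Ideal.absNorm (Ideal.span {x}) := by
  rw [InfinitePlace.prod_eq_abs_norm, Ideal.absNorm_span_singleton, ← Algebra.coe_norm_int]
  simp [Nat.cast_natAbs]

/-- A common divisor `G` of `a` and `b` and common bounds for their archimedean absolute values
control the height of `a / b`. -/
theorem mulHeight₁_div_mul_absNorm_le {a b : 𝓞 K} (hb : b ≠ 0) {G : Ideal (𝓞 K)}
    (haG : a ∈ G) (hbG : b ∈ G) {B : InfinitePlace K → ℝ} (haB : ∀ w : InfinitePlace K, w a ≤ B w)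
    (hbB : ∀ w : InfinitePlace K, w b ≤ B w) :
    Height.mulHeight₁ ((a : K) / b) * Ideal.absNorm G ≤ ∏ w, B w ^ w.mult := by
  have hx : (![a, b] : Fin 2 → 𝓞 K) ≠ 0 := fun h ↦ hb (congrFun h 1)
  have hx' : (![(a : K), b] : Fin 2 → K) ≠ 0 := fun h ↦ hb (by simpa using congrFun h 1)
  have hfin := absNorm_mul_finprod_finitePlace_eq_one hx
  have hcoe (i : Fin 2) : (![(a : K), b] : Fin 2 → K) i = ((![a, b] : Fin 2 → 𝓞 K) i : K) := by
    fin_cases i <;> rfl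
  rw [Height.mulHeight₁_div_eq_mulHeight, NumberField.mulHeight_eq hx']
  simp only [hcoe]
  set F : ℝ := ∏ᶠ v : FinitePlace K, ⨆ i, v ((![a, b] : Fin 2 → 𝓞 K) i : K)
  have hF0 : 0 ≤ F := finprod_nonneg fun v ↦ Real.iSup_nonneg fun i ↦ apply_nonneg v _
  have hspan : Ideal.span (Set.range (![a, b] : Fin 2 → 𝓞 K)) ≤ G := by
    rw [Ideal.span_le]
    rintro _ ⟨i, rfl⟩
    fin_cases i
    exacts [haG, hbG]
  have hGle : (Ideal.absNorm G : ℝ) ≤ Ideal.absNorm (Ideal.span (Set.range ![a, b])) := by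
    refine Nat.cast_le.2 (Nat.le_of_dvd ?_ (Ideal.absNorm_dvd_absNorm_of_le hspan))
    rw [Nat.pos_iff_ne_zero]
    intro h0
    rw [h0] at hfin
    simp at hfin
  calc (∏ w : InfinitePlace K, (⨆ i, w ((![a, b] : Fin 2 → 𝓞 K) i : K)) ^ w.mult) * F *
        Ideal.absNorm G
      = (∏ w : InfinitePlace K, (⨆ i, w ((![a, b] : Fin 2 → 𝓞 K) i : K)) ^ w.mult) *
        (Ideal.absNorm G * F) := by ring
    _ ≤ (∏ w, B w ^ w.mult) * 1 := by
        have h0 (w : InfinitePlace K) : 0 ≤ ⨆ i, w ((![a, b] : Fin 2 → 𝓞 K) i : K) :=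
          Real.iSup_nonneg fun i ↦ apply_nonneg w _
        gcongr with w
        · exact Finset.prod_nonneg fun w _ ↦ pow_nonneg ((apply_nonneg w _).trans (haB w)) _
        · exact fun w _ ↦ pow_nonneg (h0 w) _
        · exact h0 w
        · refine ciSup_le fun i ↦ ?_
          fin_cases i
          exacts [haB w, hbB w]
        · rw [← hfin]
          gcongr
    _ = _ := mul_one _

end ArchimedeanSize

/-! ### Reduced elements of ideals with an `ℓ`-torsion class -/

section ReducedRepresentatives

variable {K : Type*} [Field K] [NumberField K]

theorem absNorm_cast_pos {I : Ideal (𝓞 K)} (hI : I ≠ ⊥) : 0 < (Ideal.absNorm I : ℝ) := by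
  rw [Nat.cast_pos, Nat.pos_iff_ne_zero]
  simpa [Ideal.absNorm_eq_zero_iff] using hI

theorem prod_const_pow_mult (c : ℝ) :
    ∏ w : InfinitePlace K, c ^ w.mult = c ^ Module.finrank ℚ K := by
  rw [Finset.prod_pow_eq_pow_sum, InfinitePlace.sum_mult_eq]

/-- Let `I ^ ℓ = (γ)`. The weights `|γ|_w ^ (1 / ℓ) * N(P) ^ (1 / d)` turn `I * P` into a metrized
ideal of volume `√D_K`. Minkowski's theorem yields a small element `x` of it, which is recorded by
the complementary ideal `A = (x) * (I * P)⁻¹` and by the relative sizes `z w` of `x`. -/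
theorem exists_reduced {ℓ : ℕ} (hℓ : ℓ ≠ 0) {I P : Ideal (𝓞 K)} (hP : P ≠ ⊥) {γ : 𝓞 K}
    (hγ : γ ≠ 0) (hI : I ^ ℓ = Ideal.span {γ}) {T : ℝ} (hT : 0 < T)
    (hTD : T ^ Module.finrank ℚ K = 2 * √(absDiscr K)) :
    ∃ (x : 𝓞 K) (A : Ideal (𝓞 K)) (z : InfinitePlace K → ℝ), x ≠ 0 ∧ A ≠ ⊥ ∧
      Ideal.span {x} = I * P * A ∧ (∀ w, 0 < z w ∧ z w < T) ∧
      ∏ w, z w ^ w.mult = Ideal.absNorm A ∧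
      ∀ w : InfinitePlace K, w x ^ ℓ =
        z w ^ ℓ * w γ * (Ideal.absNorm P : ℝ) ^ ((ℓ : ℝ) / Module.finrank ℚ K) := by
  set d := Module.finrank ℚ K
  have hd : d ≠ 0 := Module.finrank_pos.ne'
  have hd' : (d : ℝ) ≠ 0 := Nat.cast_ne_zero.2 hd
  have hℓ' : (ℓ : ℝ) ≠ 0 := Nat.cast_ne_zero.2 hℓ
  have hI0 : I ≠ ⊥ := by
    rintro rfl
    rw [← Ideal.zero_eq_bot, zero_pow hℓ, Ideal.zero_eq_bot, eq_comm,
      Ideal.span_singleton_eq_bot] at hI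
    exact hγ hI
  have hIP : I * P ≠ ⊥ := mul_ne_zero hI0 hP
  have hNP : 0 < (Ideal.absNorm P : ℝ) := absNorm_cast_pos hP
  have hwγ (w : InfinitePlace K) : 0 < w (γ : K) := by
    rw [InfinitePlace.pos_iff]
    exact_mod_cast hγ
  let b : InfinitePlace K → ℝ := fun w ↦
    w (γ : K) ^ (1 / (ℓ : ℝ)) * (Ideal.absNorm P : ℝ) ^ (1 / (d : ℝ))
  have hb (w) : 0 < b w := mul_pos (Real.rpow_pos_of_pos (hwγ w) _) (Real.rpow_pos_of_pos hNP _)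
  have hprod : ∏ w, b w ^ w.mult = Ideal.absNorm (I * P) := by
    simp only [b, mul_pow, Finset.prod_mul_distrib, prod_const_pow_mult, map_mul, Nat.cast_mul]
    congr 1
    · refine (pow_left_inj₀ ?_ (Nat.cast_nonneg _) hℓ).1 ?_
      · exact Finset.prod_nonneg fun w _ ↦ pow_nonneg (Real.rpow_nonneg (hwγ w).le _) _
      · rw [← Nat.cast_pow, ← map_pow, hI, ← prod_infinitePlace_eq_absNorm_span,
          ← Finset.prod_pow]
        refine Finset.prod_congr rfl fun w _ ↦ ?_
        rw [← pow_mul, mul_comm, pow_mul, one_div, Real.rpow_inv_natCast_pow (hwγ w).le hℓ]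
    · rw [one_div, Real.rpow_inv_natCast_pow hNP.le hd]
  obtain ⟨x, hx, hx0, hlt⟩ := exists_ne_zero_mem_ideal_forall_lt hIP (f := fun w ↦ T * b w)
    (fun w ↦ mul_pos hT (hb w)) (by
      simp only [mul_pow, Finset.prod_mul_distrib, prod_const_pow_mult, hprod]
      exact (congrArg (· * _) hTD.symm).le)
  obtain ⟨A, hA⟩ : I * P ∣ Ideal.span {x} := by
    rwa [Ideal.dvd_span_singleton]
  have hwx (w : InfinitePlace K) : 0 < w (x : K) := by
    rw [InfinitePlace.pos_iff]
    exact_mod_cast hx0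
  refine ⟨x, A, fun w ↦ w (x : K) / b w, hx0, ?_, hA, fun w ↦ ⟨div_pos (hwx w) (hb w), ?_⟩, ?_,
    fun w ↦ ?_⟩
  · rintro rfl
    rw [Ideal.mul_bot, Ideal.span_singleton_eq_bot] at hA
    exact hx0 hA
  · rw [div_lt_iff₀ (hb w)]
    exact hlt w
  · simp only [div_pow, Finset.prod_div_distrib]
    rw [hprod, prod_infinitePlace_eq_absNorm_span, hA, map_mul _ (I * P), Nat.cast_mul,
      mul_div_cancel_left₀ _ (absNorm_cast_pos hIP).ne']
  · have hbℓ : b w ^ ℓ = w (γ : K) * (Ideal.absNorm P : ℝ) ^ ((ℓ : ℝ) / d) := by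
      simp only [b]
      rw [mul_pow, one_div, Real.rpow_inv_natCast_pow (hwγ w).le hℓ, ← Real.rpow_mul_natCast hNP.le]
      congr 2
      ring
    rw [mul_assoc, ← hbℓ, ← mul_pow, div_mul_cancel₀ _ (hb w).ne']

/-- The sizes `z w` of a reduced element are bounded below, because their product is at least `1`
while each of them is at most `T`. -/
theorem log_sub_log_le {T X : ℝ} (hTX : T ^ Module.finrank ℚ K = X)
    {z : InfinitePlace K → ℝ} (hz : ∀ w, 0 < z w ∧ z w < T) (hprod : 1 ≤ ∏ w, z w ^ w.mult)
    (w : InfinitePlace K) : Real.log T - Real.log (z w) ≤ Real.log X := by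
  have hlog : 0 ≤ ∑ v : InfinitePlace K, v.mult * Real.log (z v) := by
    have := Real.log_nonneg hprod
    rw [Real.log_prod fun v _ ↦ (pow_pos (hz v).1 _).ne'] at this
    simpa [Real.log_pow] using this
  have hsum : ∑ v : InfinitePlace K, (v.mult : ℝ) * (Real.log T - Real.log (z v)) ≤ Real.log X := by
    simp only [mul_sub, Finset.sum_sub_distrib, ← Finset.sum_mul]
    rw [← Nat.cast_sum, InfinitePlace.sum_mult_eq, ← Real.log_pow, hTX]
    linarith
  have hnonneg (v : InfinitePlace K) : 0 ≤ Real.log T - Real.log (z v) :=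
    sub_nonneg.2 (Real.log_le_log (hz v).1 (hz v).2.le)
  refine le_trans ?_ ((Finset.single_le_sum (fun v _ ↦ mul_nonneg (Nat.cast_nonneg v.mult)
    (hnonneg v)) (Finset.mem_univ w)).trans hsum)
  refine le_mul_of_one_le_left (hnonneg w) ?_
  exact_mod_cast w.mult_pos

/-- If two reduced elements have the same complementary ideal `A` and nearly the same sizes, then
`(P * P'⁻¹) ^ ℓ` has a generator of height about `max (N P) (N P') ^ ℓ`. -/
theorem mulHeight₁_quotient_le {ℓ : ℕ} {κ Q : ℝ} (hκ : 0 ≤ κ)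
    {I I' P P' A : Ideal (𝓞 K)} {γ γ' x x' : 𝓞 K} {z z' : InfinitePlace K → ℝ}
    (hγ : γ ≠ 0) (hγ' : γ' ≠ 0) (hx' : x' ≠ 0) (hA : A ≠ ⊥)
    (hI : I ^ ℓ = Ideal.span {γ}) (hI' : I' ^ ℓ = Ideal.span {γ'})
    (hxA : Ideal.span {x} = I * P * A) (hxA' : Ideal.span {x'} = I' * P' * A)
    (hz : ∀ w, 0 < z w) (hz' : ∀ w, 0 < z' w)
    (hzz' : ∀ w, z w ≤ Real.exp κ * z' w) (hprod : ∏ w, z' w ^ w.mult = Ideal.absNorm A)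
    (hx : ∀ w : InfinitePlace K, w x ^ ℓ =
      z w ^ ℓ * w γ * (Ideal.absNorm P : ℝ) ^ ((ℓ : ℝ) / Module.finrank ℚ K))
    (hxx' : ∀ w : InfinitePlace K, w x' ^ ℓ =
      z' w ^ ℓ * w γ' * (Ideal.absNorm P' : ℝ) ^ ((ℓ : ℝ) / Module.finrank ℚ K))
    (hPQ : (Ideal.absNorm P : ℝ) ≤ Q) (hPQ' : (Ideal.absNorm P' : ℝ) ≤ Q) :
    Height.mulHeight₁ (((x ^ ℓ * γ' : 𝓞 K) : K) / ((x' ^ ℓ * γ : 𝓞 K) : K)) ≤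
      Real.exp (Module.finrank ℚ K * ℓ * κ) * Q ^ ℓ := by
  set d := Module.finrank ℚ K
  have hd : (d : ℝ) ≠ 0 := Nat.cast_ne_zero.2 Module.finrank_pos.ne'
  have hQ : 0 ≤ Q := (Nat.cast_nonneg _).trans hPQ
  have hspan {y : 𝓞 K} {J L : Ideal (𝓞 K)} {c : 𝓞 K} (hJ : Ideal.span {y} = J)
      (hL : L ^ ℓ = Ideal.span {c}) : Ideal.span {y ^ ℓ * c} = (J * L) ^ ℓ := by
    rw [← Ideal.span_singleton_mul_span_singleton, ← Ideal.span_singleton_pow, hJ, ← hL, mul_pow]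
  have hG0 : (I * I' * A) ^ ℓ ≠ ⊥ := by
    have hbot {c : 𝓞 K} (hc : c ≠ 0) : Ideal.span {c} ≠ 0 := by
      rwa [Ideal.zero_eq_bot, Ne, Ideal.span_singleton_eq_bot]
    rw [mul_pow, mul_pow, hI, hI']
    exact mul_ne_zero (mul_ne_zero (hbot hγ) (hbot hγ')) (pow_ne_zero _ hA)
  have haG : x ^ ℓ * γ' ∈ (I * I' * A) ^ ℓ := by
    rw [← Ideal.dvd_span_singleton, hspan hxA hI']
    exact pow_dvd_pow_of_dvd ⟨P, by ring⟩ _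
  have hbG : x' ^ ℓ * γ ∈ (I * I' * A) ^ ℓ := by
    rw [← Ideal.dvd_span_singleton, hspan hxA' hI]
    exact pow_dvd_pow_of_dvd ⟨P', by ring⟩ _
  -- `(I * I' * A) ^ ℓ` divides numerator and denominator; `B` bounds both at the infinite places.
  let B : InfinitePlace K → ℝ := fun w ↦
    Real.exp (ℓ * κ) * z' w ^ ℓ * (w (γ : K) * w (γ' : K)) * Q ^ ((ℓ : ℝ) / d)
  have hrpow {N : ℕ} (hN : (N : ℝ) ≤ Q) : (N : ℝ) ^ ((ℓ : ℝ) / d) ≤ Q ^ ((ℓ : ℝ) / d) :=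
    Real.rpow_le_rpow (Nat.cast_nonneg _) hN (by positivity)
  have haB (w : InfinitePlace K) : w ((x ^ ℓ * γ' : 𝓞 K) : K) ≤ B w := by
    push_cast
    rw [map_mul, map_pow, hx w]
    have hzℓ : z w ^ ℓ ≤ Real.exp (ℓ * κ) * z' w ^ ℓ := by
      rw [Real.exp_nat_mul, ← mul_pow]
      exact pow_le_pow_left₀ (hz w).le (hzz' w) _
    calc z w ^ ℓ * w (γ : K) * (Ideal.absNorm P : ℝ) ^ ((ℓ : ℝ) / d) * w (γ' : K)
        = z w ^ ℓ * (w (γ : K) * w (γ' : K)) * (Ideal.absNorm P : ℝ) ^ ((ℓ : ℝ) / d) := by ring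
      _ ≤ B w := by
        simp only [B]
        have := hrpow hPQ
        have := (hz' w).le
        gcongr
  have hbB (w : InfinitePlace K) : w ((x' ^ ℓ * γ : 𝓞 K) : K) ≤ B w := by
    push_cast
    rw [map_mul, map_pow, hxx' w]
    have := (hz' w).le
    have hzℓ : z' w ^ ℓ ≤ Real.exp (ℓ * κ) * z' w ^ ℓ :=
      le_mul_of_one_le_left (by positivity) (Real.one_le_exp (by positivity))
    calc z' w ^ ℓ * w (γ' : K) * (Ideal.absNorm P' : ℝ) ^ ((ℓ : ℝ) / d) * w (γ : K)
        = z' w ^ ℓ * (w (γ : K) * w (γ' : K)) * (Ideal.absNorm P' : ℝ) ^ ((ℓ : ℝ) / d) := by ring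
      _ ≤ B w := by
        simp only [B]
        have := hrpow hPQ'
        gcongr
  have hBprod : ∏ w, B w ^ w.mult =
      Real.exp (d * ℓ * κ) * Q ^ ℓ * Ideal.absNorm ((I * I' * A) ^ ℓ) := by
    have h1 : ∏ w : InfinitePlace K, (z' w ^ ℓ) ^ w.mult = (Ideal.absNorm A : ℝ) ^ ℓ := by
      rw [← hprod, ← Finset.prod_pow]
      exact Finset.prod_congr rfl fun w _ ↦ by rw [← pow_mul, ← pow_mul, mul_comm]
    have h2 : (Q ^ ((ℓ : ℝ) / d)) ^ d = Q ^ ℓ := by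
      rw [← Real.rpow_mul_natCast hQ, div_mul_cancel₀ _ hd, Real.rpow_natCast]
    simp only [B, mul_pow, Finset.prod_mul_distrib, prod_const_pow_mult,
      prod_infinitePlace_eq_absNorm_span, h1, hI, hI', map_mul, map_pow, Nat.cast_mul, Nat.cast_pow]
    rw [h2, ← Real.exp_nat_mul, mul_assoc (d : ℝ)]
    ring
  refine le_of_mul_le_mul_right ?_ (absNorm_cast_pos hG0)
  rw [← hBprod]
  exact mulHeight₁_div_mul_absNorm_le (mul_ne_zero (pow_ne_zero _ hx') hγ) haG hbG haB hbB

end ReducedRepresentatives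

/-! ### The invariant `eta` -/

section Eta

variable {K : Type*} [Field K] [NumberField K]

theorem eta_le_mulHeight₁ {ℓ : ℕ} {α : K} {𝔭₁ 𝔭₂ : Ideal (𝓞 K)} (hne : 𝔭₁ ≠ 𝔭₂)
    (h₁ : IsDegreeOneUnramified 𝔭₁) (h₂ : IsDegreeOneUnramified 𝔭₂)
    (h : FractionalIdeal.spanSingleton (𝓞 K)⁰ α =
      ((𝔭₁ : FractionalIdeal (𝓞 K)⁰ K) * (𝔭₂ : FractionalIdeal (𝓞 K)⁰ K)⁻¹) ^ ℓ) :
    eta K ℓ ≤ Height.mulHeight₁ α := by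
  refine csInf_le ⟨1, ?_⟩ ⟨α, rfl, 𝔭₁, 𝔭₂, hne, h₁, h₂, h⟩
  rintro _ ⟨β, rfl, -⟩
  exact Height.one_le_mulHeight₁ β

variable (K) in
/-- The alternative `eta K ℓ = 0` is the value of `sInf ∅`. -/
theorem eta_eq_zero_or_one_le (ℓ : ℕ) : eta K ℓ = 0 ∨ 1 ≤ eta K ℓ := by
  rw [eta]
  rcases Set.eq_empty_or_nonempty {h : ℝ | ∃ α : K, h = Height.mulHeight₁ α ∧
    ∃ 𝔭₁ 𝔭₂ : Ideal (𝓞 K), 𝔭₁ ≠ 𝔭₂ ∧ IsDegreeOneUnramified 𝔭₁ ∧ IsDegreeOneUnramified 𝔭₂ ∧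
      FractionalIdeal.spanSingleton (𝓞 K)⁰ α =
        ((𝔭₁ : FractionalIdeal (𝓞 K)⁰ K) * (𝔭₂ : FractionalIdeal (𝓞 K)⁰ K)⁻¹) ^ ℓ} with h | h
  · left
    rw [h, Real.sInf_empty]
  · right
    refine le_csInf h ?_
    rintro _ ⟨β, rfl, -⟩
    exact Height.one_le_mulHeight₁ β

theorem IsDegreeOneUnramified.two_le_absNorm {𝔭 : Ideal (𝓞 K)} (h : IsDegreeOneUnramified 𝔭) :
    (2 : ℝ) ≤ Ideal.absNorm 𝔭 := by
  have h0 := absNorm_cast_pos h.2.1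
  have h1 : Ideal.absNorm 𝔭 ≠ 1 := fun h' ↦ h.1.ne_top (Ideal.absNorm_eq_one_iff.1 h')
  have h0 : 0 < Ideal.absNorm 𝔭 := by exact_mod_cast h0
  exact_mod_cast (show 2 ≤ Ideal.absNorm 𝔭 by omega)

end Eta

/-! ### The counting step -/

section Count

variable {K : Type*} [Field K] [NumberField K]

/-- Two reduced elements with the same complementary ideal `A` yield a generator of
`(P * P'⁻¹) ^ ℓ`. -/
theorem spanSingleton_quotient_eq {ℓ : ℕ} {I I' P P' A : Ideal (𝓞 K)} {γ γ' x x' : 𝓞 K}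
    (hP' : P' ≠ ⊥) (hγ : γ ≠ 0) (hx' : x' ≠ 0)
    (hI : I ^ ℓ = Ideal.span {γ}) (hI' : I' ^ ℓ = Ideal.span {γ'})
    (hxA : Ideal.span {x} = I * P * A) (hxA' : Ideal.span {x'} = I' * P' * A) :
    FractionalIdeal.spanSingleton (𝓞 K)⁰
        (((x ^ ℓ * γ' : 𝓞 K) : K) / ((x' ^ ℓ * γ : 𝓞 K) : K)) =
      ((P : FractionalIdeal (𝓞 K)⁰ K) * (P' : FractionalIdeal (𝓞 K)⁰ K)⁻¹) ^ ℓ := by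
  have hden : x' ^ ℓ * γ ≠ 0 := mul_ne_zero (pow_ne_zero _ hx') hγ
  have hP0 : (P' : FractionalIdeal (𝓞 K)⁰ K) ^ ℓ ≠ 0 := pow_ne_zero _ (by simpa using hP')
  have hb0 : (Ideal.span {x' ^ ℓ * γ} : FractionalIdeal (𝓞 K)⁰ K) ≠ 0 := by
    rwa [Ne, FractionalIdeal.coeIdeal_eq_zero, Ideal.span_singleton_eq_bot]
  have key : Ideal.span {x ^ ℓ * γ'} * P' ^ ℓ = P ^ ℓ * Ideal.span {x' ^ ℓ * γ} := by
    rw [← Ideal.span_singleton_mul_span_singleton, ← Ideal.span_singleton_mul_span_singleton,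
      ← Ideal.span_singleton_pow, ← Ideal.span_singleton_pow, hxA, hxA', ← hI, ← hI']
    ring
  rw [← FractionalIdeal.spanSingleton_div_spanSingleton, mul_pow, inv_pow, ← div_eq_mul_inv,
    ← FractionalIdeal.coeIdeal_span_singleton, ← FractionalIdeal.coeIdeal_span_singleton,
    div_eq_div_iff hb0 hP0]
  have := congrArg (fun J : Ideal (𝓞 K) ↦ (J : FractionalIdeal (𝓞 K)⁰ K)) key
  simpa only [FractionalIdeal.coeIdeal_mul, FractionalIdeal.coeIdeal_pow] using this

/-- The counting step: a reduced element of `I_c * 𝔭`, for `c` an `ℓ`-torsion class represented by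
`I_c` and `𝔭` one of the given primes, is described up to the factor `exp κ` by an ideal of norm at
most `2 √D_K` and one of `log (2 √D_K) / κ + 1` scales at each archimedean place. This description
determines `(c, 𝔭)`. -/
theorem card_torsion_mul_card_le {ℓ : ℕ} (hℓ : ℓ ≠ 0) {κ Q s : ℝ} (hκ : 0 < κ) (hs : 1 < s)
    (hη : Real.exp (Module.finrank ℚ K * ℓ * κ) * Q ^ ℓ < eta K ℓ) (S : Finset (Ideal (𝓞 K)))
    (hS : ∀ 𝔭 ∈ S, IsDegreeOneUnramified 𝔭 ∧ (Ideal.absNorm 𝔭 : ℝ) ≤ Q) :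
    (Nat.card (classGroupTorsion K ℓ) : ℝ) * S.card ≤
      (2 * √(absDiscr K)) ^ s * (∑' n : ℕ, (n : ℝ) ^ (-s)) ^ Module.finrank ℚ K *
        (Real.log (2 * √(absDiscr K)) / κ + 1) ^ Module.finrank ℚ K := by
  classical
  set d := Module.finrank ℚ K with hd_def
  set X := 2 * √(absDiscr K)
  have hd : d ≠ 0 := Module.finrank_pos.ne'
  have hX2 : 2 ≤ X := by
    have := Real.one_le_sqrt.2 (one_le_absDiscr (K := K))
    simp only [X]; linarith
  have hX : 0 < X := by linarith
  have hlogX : 0 ≤ Real.log X := Real.log_nonneg (by linarith)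
  let T : ℝ := X ^ (1 / (d : ℝ))
  have hT : 0 < T := Real.rpow_pos_of_pos hX _
  have hTX : T ^ d = X := by
    simp only [T]; rw [one_div, Real.rpow_inv_natCast_pow hX.le hd]
  have hrep (c : classGroupTorsion K ℓ) : ∃ (I : (Ideal (𝓞 K))⁰) (γ : 𝓞 K), γ ≠ 0 ∧
      ClassGroup.mk0 I = c ∧ (I : Ideal (𝓞 K)) ^ ℓ = Ideal.span {γ} := by
    obtain ⟨I, hI⟩ := ClassGroup.mk0_surjective (c : ClassGroup (𝓞 K))
    have hc : (c : ClassGroup (𝓞 K)) ^ ℓ = 1 := c.2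
    rw [← hI, ← map_pow] at hc
    obtain ⟨γ, hγ⟩ := ((ClassGroup.mk0_eq_one_iff (I ^ ℓ).2).1 hc).principal
    have hγ : (I : Ideal (𝓞 K)) ^ ℓ = Ideal.span {γ} := hγ
    refine ⟨I, γ, ?_, hI, hγ⟩
    rintro rfl
    exact pow_ne_zero ℓ (nonZeroDivisors.coe_ne_zero I) (by simpa using hγ)
  choose I γ hγ hIc hIγ using hrep
  have hred (q : classGroupTorsion K ℓ × S) := exists_reduced hℓ (P := q.2.1)
    (hS q.2.1 q.2.2).1.2.1 (hγ q.1) (hIγ q.1) hT hTX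
  choose x A z hx hA hxA hz hprod hxz using hred
  have hlog (q w) : Real.log T - Real.log (z q w) ≤ Real.log X := by
    refine log_sub_log_le hTX (hz q) ?_ w
    rw [hprod, Nat.one_le_cast]
    exact Nat.pos_of_ne_zero fun h ↦ hA q (Ideal.absNorm_eq_zero_iff.1 h)
  have hlog0 (q w) : 0 ≤ Real.log T - Real.log (z q w) :=
    sub_nonneg.2 (Real.log_le_log (hz q w).1 (hz q w).2.le)
  have hNA (q) : (Ideal.absNorm (A q) : ℝ) ≤ X := by
    rw [← hprod, ← hTX, hd_def, ← prod_const_pow_mult]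
    refine Finset.prod_le_prod (fun w _ ↦ pow_nonneg (hz q w).1.le _) fun w _ ↦ ?_
    exact pow_le_pow_left₀ (hz q w).1.le (hz q w).2.le _
  let scale (q : classGroupTorsion K ℓ × S) (w : InfinitePlace K) : ℕ :=
    ⌊(Real.log T - Real.log (z q w)) / κ⌋₊
  have hclose (q r) (h : scale q = scale r) (w) : z q w ≤ Real.exp κ * z r w := by
    have h1 := Nat.floor_le (div_nonneg (hlog0 q w) hκ.le)
    have h2 := Nat.lt_floor_add_one ((Real.log T - Real.log (z r w)) / κ)
    rw [show ⌊(Real.log T - Real.log (z q w)) / κ⌋₊ = ⌊(Real.log T - Real.log (z r w)) / κ⌋₊ from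
      congrFun h w] at h1
    rw [le_div_iff₀ hκ] at h1
    rw [div_lt_iff₀ hκ] at h2
    rw [← Real.log_le_log_iff (hz q w).1 (mul_pos (Real.exp_pos _) (hz r w).1),
      Real.log_mul (Real.exp_pos _).ne' (hz r w).1.ne', Real.log_exp]
    linarith
  let 𝒜 : Finset (Ideal (𝓞 K)) := Finset.univ.image A
  let cells : Finset (InfinitePlace K → ℕ) :=
    Fintype.piFinset fun _ ↦ Finset.range (⌊Real.log X / κ⌋₊ + 1)
  have hinj : Function.Injective fun q ↦ (A q, scale q) := by
    rintro ⟨c, 𝔭⟩ ⟨c', 𝔭'⟩ h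
    obtain ⟨hAA, hscale⟩ := Prod.ext_iff.1 h
    replace hAA : A (c, 𝔭) = A (c', 𝔭') := hAA
    have hxA₁ := hxA (c, 𝔭)
    have hxA₂ := hxA (c', 𝔭')
    have hprod₂ := hprod (c', 𝔭')
    rw [← hAA] at hxA₂ hprod₂
    obtain ⟨hp, hpQ⟩ := hS 𝔭.1 𝔭.2
    obtain ⟨hp', hpQ'⟩ := hS 𝔭'.1 𝔭'.2
    have h𝔭 : 𝔭 = 𝔭' := by
      by_contra hne
      refine (hη.trans_le (eta_le_mulHeight₁ (fun h ↦ hne (Subtype.ext h)) hp hp'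
        (spanSingleton_quotient_eq hp'.2.1 (hγ c) (hx (c', 𝔭')) (hIγ c) (hIγ c')
          hxA₁ hxA₂))).not_ge ?_
      exact mulHeight₁_quotient_le hκ.le (hγ c) (hγ c') (hx _) (hA _) (hIγ c) (hIγ c') hxA₁ hxA₂
        (fun w ↦ (hz _ w).1) (fun w ↦ (hz _ w).1) (hclose _ _ hscale) hprod₂ (hxz _) (hxz _)
        hpQ hpQ'
    subst h𝔭
    refine Prod.ext (Subtype.ext ?_) rfl
    rw [← hIc c, ← hIc c', ClassGroup.mk0_eq_mk0_iff]
    refine ⟨x (c', 𝔭), x (c, 𝔭), hx _, hx _, ?_⟩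
    rw [hxA₁, hxA₂]
    ring
  have hcard : Nat.card (classGroupTorsion K ℓ) * S.card ≤ 𝒜.card * cells.card := by
    rw [← Finset.card_product, Nat.card_eq_fintype_card, ← Fintype.card_coe S, ← Fintype.card_prod,
      ← Finset.card_univ]
    refine Finset.card_le_card_of_injOn _ (fun q _ ↦ ?_) hinj.injOn
    refine Finset.mem_product.2 ⟨Finset.mem_image_of_mem _ (Finset.mem_univ q),
      Fintype.mem_piFinset.2 fun w ↦ Finset.mem_range.2 (Nat.lt_succ_of_le ?_)⟩
    exact Nat.floor_le_floor (div_le_div_of_nonneg_right (hlog q w) hκ.le)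
  have h𝒜 : (𝒜.card : ℝ) ≤ X ^ s * (∑' n : ℕ, (n : ℝ) ^ (-s)) ^ d := by
    refine card_ideals_le hs hX.le 𝒜 fun J hJ ↦ ?_
    obtain ⟨q, -, rfl⟩ := Finset.mem_image.1 hJ
    exact ⟨hA q, hNA q⟩
  have hcells : (cells.card : ℝ) ≤ (Real.log X / κ + 1) ^ d := by
    have hplaces : Fintype.card (InfinitePlace K) ≤ d := by
      rw [hd_def, ← InfinitePlace.sum_mult_eq, ← Finset.card_univ, Finset.card_eq_sum_ones]
      exact Finset.sum_le_sum fun w _ ↦ w.mult_pos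
    have hbase : 0 ≤ Real.log X / κ := div_nonneg hlogX hκ.le
    simp only [cells, Fintype.card_piFinset, Finset.card_range, Finset.prod_const, Finset.card_univ]
    push_cast
    calc ((⌊Real.log X / κ⌋₊ : ℝ) + 1) ^ Fintype.card (InfinitePlace K)
        ≤ (Real.log X / κ + 1) ^ Fintype.card (InfinitePlace K) := by
          gcongr
          exact Nat.floor_le hbase
      _ ≤ _ := pow_le_pow_right₀ (by linarith) hplaces
  calc (Nat.card (classGroupTorsion K ℓ) : ℝ) * S.card ≤ 𝒜.card * cells.card := by
        exact_mod_cast hcard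
    _ ≤ _ := by
      gcongr

end Count

/-! ### Choice of constants -/

section Constants

/-- The choice of `κ`: since `2 ≤ η ^ δ` and `δ < 1 / ℓ`, the number `η ^ (1 - δ * ℓ)` exceeds a
constant greater than `1` that depends only on `δ` and `ℓ`. -/
theorem exp_mul_rpow_pow_lt {d ℓ : ℕ} (hd : 0 < d) (hℓ : 0 < ℓ) {δ η : ℝ} (hδ : 0 < δ)
    (hδℓ : δ < 1 / (ℓ : ℝ)) (hη : 0 ≤ η) (h2 : 2 ≤ η ^ δ) :
    Real.exp (d * ℓ * (Real.log 2 * (1 - δ * ℓ) / (2 * δ * d * ℓ))) * (η ^ δ) ^ ℓ < η := by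
  have hd' : (0 : ℝ) < d := Nat.cast_pos.2 hd
  have hℓ' : (0 : ℝ) < ℓ := Nat.cast_pos.2 hℓ
  rw [lt_div_iff₀ hℓ'] at hδℓ
  have hη0 : 0 < η := by
    refine hη.lt_of_ne' ?_
    rintro rfl
    rw [Real.zero_rpow hδ.ne'] at h2
    linarith
  have hlog2 : 0 < Real.log 2 := Real.log_pos one_lt_two
  have hlog : Real.log 2 ≤ δ * Real.log η := by
    rw [← Real.log_rpow hη0]
    exact Real.log_le_log two_pos h2
  rw [← Real.log_lt_log_iff (by positivity) hη0, Real.log_mul (by positivity) (by positivity),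
    Real.log_exp, Real.log_pow, Real.log_rpow hη0,
    show (d : ℝ) * ℓ * (Real.log 2 * (1 - δ * ℓ) / (2 * δ * d * ℓ)) =
      Real.log 2 / δ * ((1 - δ * ℓ) / 2) by field_simp]
  have h1 : Real.log 2 / δ ≤ Real.log η := by
    rw [div_le_iff₀ hδ]; linarith
  have h3 : 0 < Real.log 2 / δ := by positivity
  nlinarith [mul_le_mul_of_nonneg_right h1 (show 0 ≤ (1 - δ * ℓ) / 2 by linarith)]

/-- The power of the logarithm is absorbed by an arbitrarily small power. -/
theorem log_div_add_one_pow_le {d : ℕ} (hd : 0 < d) {κ ε X : ℝ} (hκ : 0 < κ) (hε : 0 < ε)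
    (hX : 1 ≤ X) : (Real.log X / κ + 1) ^ d ≤ (d / (ε * κ) + 1) ^ d * X ^ ε := by
  have hd' : (0 : ℝ) < d := Nat.cast_pos.2 hd
  have h1 : 1 ≤ X ^ (ε / d) := Real.one_le_rpow hX (by positivity)
  have h2 : Real.log X ≤ X ^ (ε / d) / (ε / d) := Real.log_le_rpow_div (by linarith) (by positivity)
  have h3 : (X ^ (ε / d)) ^ d = X ^ ε := by
    rw [← Real.rpow_mul_natCast (by linarith), div_mul_cancel₀ _ hd'.ne']
  rw [← h3, ← mul_pow]
  have h0 : 0 ≤ Real.log X := Real.log_nonneg hX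
  gcongr
  calc Real.log X / κ + 1 ≤ X ^ (ε / d) / (ε / d) / κ + X ^ (ε / d) := by gcongr
    _ = _ := by field_simp

end Constants

/-! ### Conclusion -/

/-- The bound for a single value of `ℓ`. -/
theorem exists_card_torsion_le_of_pos (d : ℕ) {δ ε : ℝ} (hδ : 0 < δ) (hε : 0 < ε) (ℓ : ℕ) :
    ∃ C : ℝ, 0 < C ∧ (1 ≤ ℓ → δ < 1 / (ℓ : ℝ) →
      ∀ (K : Type*) [Field K] [NumberField K], Module.finrank ℚ K = d →
      ∀ S : Finset (Ideal (𝓞 K)), S.Nonempty →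
        (∀ 𝔭 ∈ S, IsDegreeOneUnramified 𝔭 ∧ (Ideal.absNorm 𝔭 : ℝ) ≤ eta K ℓ ^ δ) →
        (Nat.card (classGroupTorsion K ℓ) : ℝ) ≤
          C * absDiscr K ^ (1 / 2 + ε) * (S.card : ℝ)⁻¹) := by
  by_cases hyp : 0 < d ∧ 1 ≤ ℓ ∧ δ < 1 / (ℓ : ℝ)
  swap
  · refine ⟨1, one_pos, fun hℓ hδℓ K _ _ hK ↦ ?_⟩
    exact absurd ⟨hK ▸ Module.finrank_pos, hℓ, hδℓ⟩ hyp
  obtain ⟨hd, hℓ, hδℓ⟩ := hyp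
  have hd' : (0 : ℝ) < d := Nat.cast_pos.2 hd
  have hℓ' : (0 : ℝ) < ℓ := Nat.cast_pos.2 hℓ
  set κ := Real.log 2 * (1 - δ * ℓ) / (2 * δ * d * ℓ) with hκ_def
  have hκ : 0 < κ := by
    have : 0 < 1 - δ * ℓ := by rw [lt_div_iff₀ hℓ'] at hδℓ; linarith
    have := Real.log_pos one_lt_two
    positivity
  set Z := ∑' n : ℕ, (n : ℝ) ^ (-(1 + ε))
  have hZ : 0 < Z := by
    have hsum : Summable fun n : ℕ ↦ (n : ℝ) ^ (-(1 + ε)) :=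
      Real.summable_nat_rpow.2 (by linarith)
    exact hsum.tsum_pos (fun n ↦ by positivity) 1 (by simp)
  refine ⟨2 ^ (1 + 2 * ε) * Z ^ d * (d / (ε * κ) + 1) ^ d, by positivity,
    fun _ _ K _ _ hK S hSne hS ↦ ?_⟩
  subst hK
  have hSpos : (0 : ℝ) < S.card := Nat.cast_pos.2 hSne.card_pos
  have h2 : 2 ≤ eta K ℓ ^ δ := by
    obtain ⟨𝔭, h𝔭⟩ := hSne
    exact (hS 𝔭 h𝔭).1.two_le_absNorm.trans (hS 𝔭 h𝔭).2
  have hη : 0 ≤ eta K ℓ := by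
    rcases eta_eq_zero_or_one_le K ℓ with h | h
    · exact h.ge
    · linarith
  have hcount := card_torsion_mul_card_le (s := 1 + ε) (by omega) hκ (by linarith)
    (exp_mul_rpow_pow_lt hd hℓ hδ hδℓ hη h2) S hS
  have hD : 1 ≤ absDiscr K := one_le_absDiscr
  have hsqrt : 1 ≤ √(absDiscr K) := Real.one_le_sqrt.2 hD
  set X := 2 * √(absDiscr K) with hX_def
  have hX : 1 ≤ X := by linarith
  have hXpow : X ^ (1 + ε) * X ^ ε = 2 ^ (1 + 2 * ε) * absDiscr K ^ (1 / 2 + ε) := by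
    rw [← Real.rpow_add (by linarith), hX_def, Real.mul_rpow two_pos.le (Real.sqrt_nonneg _),
      Real.sqrt_eq_rpow, ← Real.rpow_mul (by linarith)]
    congr 2 <;> ring
  rw [← div_eq_mul_inv, le_div_iff₀ hSpos]
  calc (Nat.card (classGroupTorsion K ℓ) : ℝ) * S.card
      ≤ X ^ (1 + ε) * Z ^ Module.finrank ℚ K *
        (Real.log X / κ + 1) ^ Module.finrank ℚ K := hcount
    _ ≤ X ^ (1 + ε) * Z ^ Module.finrank ℚ K *
        ((Module.finrank ℚ K / (ε * κ) + 1) ^ Module.finrank ℚ K * X ^ ε) := by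
        gcongr
        exact log_div_add_one_pow_le hd hκ hε hX
    _ = (X ^ (1 + ε) * X ^ ε) * Z ^ Module.finrank ℚ K *
        (Module.finrank ℚ K / (ε * κ) + 1) ^ Module.finrank ℚ K := by ring
    _ = _ := by rw [hXpow]; ring

theorem proposition2p1 (d : ℕ) (δ ε : ℝ) (hε : 0 < ε) :
    ∃ C : ℝ, 0 < C ∧
      ∀ (ℓ : ℕ), 1 ≤ ℓ → δ < 1 / (ℓ : ℝ) →
      ∀ (K : Type*) [Field K] [NumberField K], Module.finrank ℚ K = d →
      ∀ (M : ℕ), 0 < M →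
        (∃ S : Finset (Ideal (𝓞 K)), S.card = M ∧
          ∀ 𝔭 ∈ S, IsDegreeOneUnramified 𝔭 ∧ (Ideal.absNorm 𝔭 : ℝ) ≤ eta K ℓ ^ δ) →
        (Nat.card (classGroupTorsion K ℓ) : ℝ) ≤
          C * absDiscr K ^ (1 / 2 + ε) * (M : ℝ)⁻¹ := by
  by_cases hδ : 0 < δ
  · choose C hC hbound using exists_card_torsion_le_of_pos d hδ hε
    -- Only finitely many `ℓ` satisfy `δ < 1 / ℓ`, so the constants may be added up.
    have hCsum : 0 ≤ ∑ ℓ ∈ Finset.range (⌈1 / δ⌉₊ + 1), C ℓ :=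
      Finset.sum_nonneg fun ℓ _ ↦ (hC ℓ).le
    refine ⟨1 + ∑ ℓ ∈ Finset.range (⌈1 / δ⌉₊ + 1), C ℓ, by linarith, ?_⟩
    rintro ℓ hℓ hδℓ K _ _ hK _ hM ⟨S, rfl, hS⟩
    refine (hbound ℓ hℓ hδℓ K hK S (Finset.card_pos.1 hM) hS).trans ?_
    have hℓle : ℓ ≤ ⌈1 / δ⌉₊ := by
      have hℓ' : (0 : ℝ) < ℓ := Nat.cast_pos.2 hℓ
      have : (ℓ : ℝ) ≤ 1 / δ := by
        rw [lt_div_iff₀ hℓ'] at hδℓ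
        rw [le_div_iff₀ hδ]
        linarith
      exact_mod_cast this.trans (Nat.le_ceil _)
    have hCℓ : C ℓ ≤ ∑ ℓ ∈ Finset.range (⌈1 / δ⌉₊ + 1), C ℓ :=
      Finset.single_le_sum (fun ℓ _ ↦ (hC ℓ).le) (Finset.mem_range.2 (by omega))
    have hD : 1 ≤ absDiscr K := one_le_absDiscr
    gcongr
    linarith
  · -- For `δ ≤ 0` one has `η ^ δ ≤ 1`, so there are no primes of norm at most `η ^ δ`.
    refine ⟨1, one_pos, ?_⟩
    rintro ℓ - - K _ _ - _ hM ⟨S, rfl, hS⟩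
    obtain ⟨𝔭, h𝔭⟩ := Finset.card_pos.1 hM
    have h2 := (hS 𝔭 h𝔭).1.two_le_absNorm.trans (hS 𝔭 h𝔭).2
    have h1 : eta K ℓ ^ δ ≤ 1 := by
      rcases eta_eq_zero_or_one_le K ℓ with h | h
      · rw [h]
        exact Real.zero_rpow_le_one δ
      · exact Real.rpow_le_one_of_one_le_of_nonpos h (not_lt.1 hδ)
    linarith
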